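/- Let $\mathbb{N}=\{1,2,3,\dots\}$. For finite sets $E,F\subset\mathbb{N}$ write $E<F$ if every element of $E$ is smaller than every element of $F$. Define families $S_\xi$ $(0\le\xi<\omega)$ of finite subsets of $\mathbb{N}$ by $S_0=\{\emptyset\}\cup\{\{n\}:n\in\mathbb{N}\}$ and $$S_{\xi+1}=\{\emptyset\}\cup\Bigl\{\bigcup_{i=1}^nF_i:\ n\in\mathbb{N},\ F_1<\dots<F_n,\ \emptyset\ne F_i\in S_\xi\ (i\le n),\ n\le\min F_1\Bigr\}.$$ Let $X^\xi$ be the (real) Schreier space of order $\xi$, i.e. the completion of the space $c_{00}$ of finitely supported real sequences $x=(x(n))_{n\in\mathbb{N}}$ under the norm $\|x\|_\xi=\sup_{F\in S_\xi}\sum_{n\in F}|x(n)|$, let $(e_n^\xi)$ be its unit vector basis, and for an infinite set $M\subset\mathbb{N}$ let $X_M^\xi$ be the closed linear span of $\{e_n^\xi:n\in M\}$ in $X^\xi$. Theorem. For every $1\le\xi<\omega$ there exists a set $\mathcal{A}$ (depending on $\xi$) consisting of infinite subsets of $\mathbb{N}$ such that: 1. the cardinality of $\mathcal{A}$ is equal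 to the continuum; 2. for every pair $(L,M)$ of distinct elements of $\mathcal{A}$, the Banach spaces $X_L^\xi$ and $X_M^\xi$ are incomparable: neither of them is isomorphic (linearly homeomorphic) to a closed linear subspace of the other. -/

import Mathlib

noncomputable section

/-- `E < F` for finite sets of positive integers: every element of `E` is smaller than every
element of `F`. -/
def BlockLT (E F : Finset ℕ+) : Prop := ∀ a ∈ E, ∀ b ∈ F, a < b

/-- The Schreier families `S_ξ`, for `ξ < ω`. `S_0` consists of the empty set and the singletons;
`S_{ξ+1}` consists of the empty set and the unions `F_1 ∪ ⋯ ∪ F_n` of nonempty members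
`F_1 < ⋯ < F_n` of `S_ξ` with `1 ≤ n ≤ min F_1` (here the index starts at `0`). -/
def SchreierFamily : ℕ → Set (Finset ℕ+)
  | 0 => {F | F = ∅ ∨ ∃ n : ℕ+, F = {n}}
  | ξ + 1 => {F | F = ∅ ∨ ∃ (n : ℕ) (hn : 0 < n) (G : Fin n → Finset ℕ+),
      (∀ i, G i ∈ SchreierFamily ξ ∧ (G i).Nonempty) ∧
      (∀ i j, i < j → BlockLT (G i) (G j)) ∧
      (∀ a ∈ G ⟨0, hn⟩, n ≤ (a : ℕ)) ∧
      F = Finset.univ.biUnion G}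

theorem empty_mem_schreierFamily (ξ : ℕ) : (∅ : Finset ℕ+) ∈ SchreierFamily ξ := by
  cases ξ <;> exact Or.inl rfl

theorem singleton_mem_schreierFamily (ξ : ℕ) (n : ℕ+) :
    ({n} : Finset ℕ+) ∈ SchreierFamily ξ := by
  induction ξ with
  | zero => exact Or.inr ⟨n, rfl⟩
  | succ ξ ih =>
    refine Or.inr ⟨1, one_pos, fun _ => {n}, fun _ => ⟨ih, Finset.singleton_nonempty n⟩, ?_, ?_, ?_⟩
    · intro i j hij
      omega
    · intro a _
      exact a.pos
    · ext a
      simp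

/-- The space `c₀₀` of finitely supported real sequences, indexed by the positive integers; the
parameter `ξ` records which norm it carries. -/
def SchreierC00 (_ξ : ℕ) : Type := ℕ+ →₀ ℝ

namespace SchreierC00

variable (ξ : ℕ)

instance : AddCommGroup (SchreierC00 ξ) := inferInstanceAs (AddCommGroup (ℕ+ →₀ ℝ))

instance : Module ℝ (SchreierC00 ξ) := inferInstanceAs (Module ℝ (ℕ+ →₀ ℝ))

variable {ξ}

/-- The `n`-th coordinate of a finitely supported sequence. -/
def coord (x : SchreierC00 ξ) (n : ℕ+) : ℝ := (show ℕ+ →₀ ℝ from x) n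

variable (ξ) in
/-- The `n`-th unit vector of `c₀₀`. -/
def basisVec (n : ℕ+) : SchreierC00 ξ := (Finsupp.single n (1 : ℝ) : ℕ+ →₀ ℝ)

/-- The norm `‖x‖_ξ = sup_{F ∈ S_ξ} ∑_{n ∈ F} |x(n)|`. -/
instance : Norm (SchreierC00 ξ) :=
  ⟨fun x => ⨆ F : SchreierFamily ξ, ∑ n ∈ F.1, |coord x n|⟩

theorem norm_def (x : SchreierC00 ξ) :
    ‖x‖ = ⨆ F : SchreierFamily ξ, ∑ n ∈ F.1, |coord x n| := rfl

instance : Nonempty (SchreierFamily ξ) := ⟨⟨∅, empty_mem_schreierFamily ξ⟩⟩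

theorem bddAbove_sums (x : SchreierC00 ξ) :
    BddAbove (Set.range fun F : SchreierFamily ξ => ∑ n ∈ F.1, |coord x n|) := by
  refine ⟨∑ n ∈ Finsupp.support (show ℕ+ →₀ ℝ from x), |coord x n|, ?_⟩
  rintro _ ⟨F, rfl⟩
  calc ∑ n ∈ F.1, |coord x n|
      ≤ ∑ n ∈ F.1 ∪ Finsupp.support (show ℕ+ →₀ ℝ from x), |coord x n| :=
        Finset.sum_le_sum_of_subset_of_nonneg Finset.subset_union_left
          fun n _ _ => abs_nonneg _
    _ = ∑ n ∈ Finsupp.support (show ℕ+ →₀ ℝ from x), |coord x n| := by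
        refine (Finset.sum_subset Finset.subset_union_right fun n _ hn => ?_).symm
        exact abs_eq_zero.mpr (Finsupp.notMem_support_iff.mp hn)

theorem sum_le_norm (x : SchreierC00 ξ) {F : Finset ℕ+} (hF : F ∈ SchreierFamily ξ) :
    ∑ n ∈ F, |coord x n| ≤ ‖x‖ :=
  le_ciSup (bddAbove_sums x) ⟨F, hF⟩

theorem normCore : NormedSpace.Core ℝ (SchreierC00 ξ) where
  norm_nonneg x := Real.iSup_nonneg fun F => Finset.sum_nonneg fun n _ => abs_nonneg _
  norm_smul c x := by
    rw [norm_def, norm_def, Real.norm_eq_abs, Real.mul_iSup_of_nonneg (abs_nonneg c)]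
    refine iSup_congr fun F => ?_
    rw [Finset.mul_sum]
    exact Finset.sum_congr rfl fun n _ => abs_mul c (coord x n)
  norm_triangle x y := by
    refine ciSup_le fun F => ?_
    calc ∑ n ∈ F.1, |coord (x + y) n|
        ≤ ∑ n ∈ F.1, (|coord x n| + |coord y n|) :=
          Finset.sum_le_sum fun n _ => abs_add_le (coord x n) (coord y n)
      _ = ∑ n ∈ F.1, |coord x n| + ∑ n ∈ F.1, |coord y n| := Finset.sum_add_distrib
      _ ≤ ‖x‖ + ‖y‖ := add_le_add (sum_le_norm x F.2) (sum_le_norm y F.2)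
  norm_eq_zero_iff x := by
    constructor
    · intro h
      refine Finsupp.ext fun n => ?_
      have h1 := sum_le_norm x (singleton_mem_schreierFamily ξ n)
      rw [h, Finset.sum_singleton] at h1
      exact abs_eq_zero.mp (le_antisymm h1 (abs_nonneg _))
    · rintro rfl
      have h0 : ∀ n, coord (0 : SchreierC00 ξ) n = 0 := fun _ => rfl
      simp [norm_def, h0]

instance : NormedAddCommGroup (SchreierC00 ξ) := NormedAddCommGroup.ofCore normCore

instance : NormedSpace ℝ (SchreierC00 ξ) := NormedSpace.ofCore normCore

end SchreierC00

/-- The Schreier space `X^ξ`: the completion of `c₀₀` under `‖·‖_ξ`. -/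
abbrev SchreierSpace (ξ : ℕ) : Type := UniformSpace.Completion (SchreierC00 ξ)

/-- The `n`-th vector `e_n^ξ` of the natural Schauder basis of `X^ξ`. -/
def schreierBasis (ξ : ℕ) (n : ℕ+) : SchreierSpace ξ :=
  ((SchreierC00.basisVec ξ n : SchreierC00 ξ) : UniformSpace.Completion (SchreierC00 ξ))

/-- `X_M^ξ`: the closed linear span of `(e_n^ξ)_{n ∈ M}` in `X^ξ`. -/
def SchreierSubspace (ξ : ℕ) (M : Set ℕ+) : Submodule ℝ (SchreierSpace ξ) :=
  (Submodule.span ℝ (schreierBasis ξ '' M)).topologicalClosure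

/-- `X` is isomorphic (linearly homeomorphic) to a closed linear subspace of `Y`. -/
def EmbedsIsomorphically (X Y : Type*) [NormedAddCommGroup X] [NormedSpace ℝ X]
    [NormedAddCommGroup Y] [NormedSpace ℝ Y] : Prop :=
  ∃ Z : Submodule ℝ Y, IsClosed (Z : Set Y) ∧ Nonempty (X ≃L[ℝ] Z)

/-- `X` and `Y` are incomparable: neither is isomorphic to a closed linear subspace of the
other. -/
def BanachIncomparable (X Y : Type*) [NormedAddCommGroup X] [NormedSpace ℝ X]
    [NormedAddCommGroup Y] [NormedSpace ℝ Y] : Prop :=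
  ¬ EmbedsIsomorphically X Y ∧ ¬ EmbedsIsomorphically Y X

end

/-! ### Schreier families -/

/-! Choose successive finite blocks `B j` inside `(q j, q (j + 1)]`, each carrying convex weights `w
j` whose norm is tiny compared with `1 / q j`. For a set `I` of indices take the union of the blocks
`B j`, `j ∈ I`. Whenever `I \ J` is infinite, the space over `I` does not embed into the space over
`J` (`IsThinBlocks.not_embeds`). Letting `I` run over an almost disjoint family of size continuum
gives the theorem.

Suppose there is such an embedding, and let `y l` be the image of the `l`-th unit vector. First, all
far out `y l` have a coordinate larger than some fixed `δ > 0` (`exists_large_coord`). Otherwise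
repeated averaging of vectors `y l` with small coordinates gives convex weights on a member of
`S_ξ`, hence of norm at least 1, with image of arbitrarily small norm.

Now take a large `j ∈ I \ J` and let `μ l` be the place of a large coordinate of `y l`, for `l ∈ B
j`. These places avoid the gap `(q j, q (j + 1)]`. Those beyond the gap are at most `q (j + 1)` in
number, so they form a member of `S_1`; those before it take at most `q j` values. On each of these
classes of `l` a choice of signs shows that `δ` times the mass of `w j` is at most `C * ‖w j‖`
(`mul_sum_le_of_large_coord`). Summing over the classes gives `δ ≤ (q j + 2) * C * ‖w j‖`, which is
false for large `j` by the choice of `w j`. -/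

theorem schreierFamily_subset_succ (ξ : ℕ) : SchreierFamily ξ ⊆ SchreierFamily (ξ + 1) := by
  intro F hF
  rcases F.eq_empty_or_nonempty with h | h
  · exact Or.inl h
  · refine Or.inr ⟨1, one_pos, fun _ => F, fun _ => ⟨hF, h⟩, ?_, fun a _ => a.pos, ?_⟩
    · intro i j hij
      omega
    · ext a
      simp

theorem schreierFamily_mono : Monotone SchreierFamily :=
  monotone_nat_of_le_succ schreierFamily_subset_succ

/-- Listed in increasing order, the points of `D` are successive members of `S_0`, and there are at
most `min D` of them. -/
theorem mem_schreierFamily_one {D : Finset ℕ+} (h : ∀ a ∈ D, D.card ≤ (a : ℕ)) :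
    D ∈ SchreierFamily 1 := by
  rcases D.eq_empty_or_nonempty with h0 | h0
  · exact Or.inl h0
  · refine Or.inr ⟨D.card, h0.card_pos, fun i => {D.orderEmbOfFin rfl i},
      fun i => ⟨Or.inr ⟨_, rfl⟩, Finset.singleton_nonempty _⟩, ?_, ?_, ?_⟩
    · intro i j hij a ha b hb
      rw [Finset.mem_singleton] at ha hb
      subst ha hb
      exact (D.orderEmbOfFin rfl).strictMono hij
    · intro a ha
      rw [Finset.mem_singleton] at ha
      subst ha
      exact h _ (D.orderEmbOfFin_mem rfl _)
    · ext a
      simp only [Finset.mem_biUnion, Finset.mem_univ, true_and, Finset.mem_singleton]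
      constructor
      · intro ha
        have : a ∈ Set.range (D.orderEmbOfFin rfl) := by
          rw [Finset.range_orderEmbOfFin]
          exact ha
        obtain ⟨i, hi⟩ := this
        exact ⟨i, hi.symm⟩
      · rintro ⟨i, rfl⟩
        exact D.orderEmbOfFin_mem rfl _

/-- The union of at most `min` many successive members of `S_ξ` belongs to `S_{ξ+1}`. -/
theorem biUnion_range_mem_schreierFamily {ξ K : ℕ} (hK : 0 < K) {B : ℕ → Finset ℕ+}
    (hB : ∀ k, B k ∈ SchreierFamily ξ) (hne : ∀ k, (B k).Nonempty)
    (hlt : ∀ i j, i < j → BlockLT (B i) (B j)) (hmin : ∀ a ∈ B 0, K ≤ (a : ℕ)) :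
    (Finset.range K).biUnion B ∈ SchreierFamily (ξ + 1) := by
  refine Or.inr ⟨K, hK, fun i => B i, fun i => ⟨hB i, hne i⟩, fun i j hij => hlt i j hij, hmin, ?_⟩
  ext a
  simp only [Finset.mem_biUnion, Finset.mem_range, Finset.mem_univ, true_and]
  exact ⟨fun ⟨k, hk, h⟩ => ⟨⟨k, hk⟩, h⟩, fun ⟨k, h⟩ => ⟨k, k.2, h⟩⟩

/-- Sums over members of `S_{ξ+1}` are controlled by sums over members of `S_ξ`. -/
theorem sum_le_of_mem_schreierFamily_succ {ξ : ℕ} {F : Finset ℕ+}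
    (hF : F ∈ SchreierFamily (ξ + 1)) {f : ℕ+ → ℝ} {η : ℝ} (hη : 0 ≤ η)
    (h : ∀ G ∈ SchreierFamily ξ, ∑ m ∈ G, f m ≤ η) {a : ℕ+} (ha : a ∈ F) :
    ∑ m ∈ F, f m ≤ a * η := by
  rcases hF with rfl | ⟨n, hn, G, hG, hlt, hmin, rfl⟩
  · simp at ha
  -- The bound `n ≤ min F_1` passes to every point of the union because the pieces are successive.
  · have hna : n ≤ (a : ℕ) := by
      obtain ⟨b, hb⟩ := (hG ⟨0, hn⟩).2
      obtain ⟨i, -, hi⟩ := Finset.mem_biUnion.1 ha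
      rcases Nat.eq_zero_or_pos (i : ℕ) with h0 | h0
      · have : i = ⟨0, hn⟩ := Fin.ext h0
        subst this
        exact hmin a hi
      · have hb' := hlt ⟨0, hn⟩ i h0 b hb a hi
        exact (hmin b hb).trans (PNat.coe_le_coe _ _ |>.2 hb'.le)
    have hdisj : ∀ i j, i ≠ j → Disjoint (G i) (G j) := by
      intro i j hij
      refine Finset.disjoint_left.2 fun x hx hy => ?_
      rcases lt_or_gt_of_ne hij with h' | h'
      · exact lt_irrefl x (hlt _ _ h' x hx x hy)
      · exact lt_irrefl x (hlt _ _ h' x hy x hx)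
    calc ∑ m ∈ Finset.univ.biUnion G, f m = ∑ i, ∑ m ∈ G i, f m :=
          Finset.sum_biUnion fun i _ j _ hij => hdisj i j hij
      _ ≤ ∑ _i : Fin n, η := Finset.sum_le_sum fun i _ => h _ (hG i).1
      _ = n * η := by simp
      _ ≤ a * η := by
        gcongr

/-! ### Coordinates in Schreier spaces -/

namespace SchreierSpace

variable {ξ : ℕ}

noncomputable section

/-- A coordinate, as a bounded functional on `c₀₀`. -/
def coordC00 (ξ : ℕ) (m : ℕ+) : SchreierC00 ξ →L[ℝ] ℝ :=
  LinearMap.mkContinuous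
    { toFun := fun x => SchreierC00.coord x m
      map_add' := fun _ _ => rfl
      map_smul' := fun _ _ => rfl } 1 (fun x => by
        have := SchreierC00.sum_le_norm x (singleton_mem_schreierFamily ξ m)
        rw [Finset.sum_singleton] at this
        rw [one_mul]
        exact this)

/-- The `m`-th coordinate functional of the Schreier space. -/
def coordL (ξ : ℕ) (m : ℕ+) : SchreierSpace ξ →L[ℝ] ℝ :=
  (coordC00 ξ m).extend UniformSpace.Completion.toComplL

theorem coordL_coe (m : ℕ+) (x : SchreierC00 ξ) :
    coordL ξ m (x : SchreierSpace ξ) = SchreierC00.coord x m :=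
  ContinuousLinearMap.extend_eq _ (e := UniformSpace.Completion.toComplL)
    UniformSpace.Completion.denseRange_coe (UniformSpace.Completion.isUniformInducing_coe _) x

theorem sum_abs_coordL_le {F : Finset ℕ+} (hF : F ∈ SchreierFamily ξ) (y : SchreierSpace ξ) :
    ∑ m ∈ F, |coordL ξ m y| ≤ ‖y‖ := by
  induction y using UniformSpace.Completion.induction_on with
  | hp => apply isClosed_le <;> fun_prop
  | ih x =>
    simp only [coordL_coe, UniformSpace.Completion.norm_coe]
    exact SchreierC00.sum_le_norm x hF

theorem exists_coe_near (y : SchreierSpace ξ) {ε : ℝ} (hε : 0 < ε) :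
    ∃ z : SchreierC00 ξ, ‖y - z‖ < ε := by
  obtain ⟨z, hz⟩ := UniformSpace.Completion.denseRange_coe.exists_dist_lt y hε
  exact ⟨z, by rwa [dist_eq_norm] at hz⟩

/-- With `sum_abs_coordL_le` this carries the supremum formula for the norm from `c₀₀` to the
completion, by density. -/
theorem norm_le_of_sum_le {y : SchreierSpace ξ} {c : ℝ}
    (h : ∀ F ∈ SchreierFamily ξ, ∑ m ∈ F, |coordL ξ m y| ≤ c) : ‖y‖ ≤ c := by
  refine le_of_forall_pos_le_add fun ε hε => ?_
  obtain ⟨z, hz⟩ := exists_coe_near y (half_pos hε)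
  have h1 : ‖z‖ ≤ c + ε / 2 := by
    rw [SchreierC00.norm_def]
    refine ciSup_le fun F => ?_
    calc ∑ n ∈ F.1, |SchreierC00.coord z n|
        ≤ ∑ n ∈ F.1, (|coordL ξ n y| + |coordL ξ n (y - z)|) := by
          refine Finset.sum_le_sum fun n _ => ?_
          rw [← coordL_coe, map_sub, abs_sub_comm]
          linarith [abs_sub_abs_le_abs_sub (coordL ξ n z) (coordL ξ n y)]
      _ ≤ c + ‖y - z‖ := by
          rw [Finset.sum_add_distrib]
          exact add_le_add (h _ F.2) (sum_abs_coordL_le F.2 _)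
      _ ≤ c + ε / 2 := by linarith
  calc ‖y‖ = ‖(z : SchreierSpace ξ) + (y - z)‖ := by rw [add_sub_cancel]
    _ ≤ ‖(z : SchreierSpace ξ)‖ + ‖y - z‖ := norm_add_le _ _
    _ ≤ c + ε := by
      rw [UniformSpace.Completion.norm_coe]
      linarith

theorem exists_tail_le (y : SchreierSpace ξ) {ε : ℝ} (hε : 0 < ε) :
    ∃ p : ℕ+, ∀ F ∈ SchreierFamily ξ, (∀ m ∈ F, p < m) → ∑ m ∈ F, |coordL ξ m y| ≤ ε := by
  obtain ⟨z, hz⟩ := exists_coe_near y hε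
  obtain ⟨p, hp⟩ := (Finsupp.support (show ℕ+ →₀ ℝ from z)).bddAbove
  refine ⟨p, fun F hF hpF => ?_⟩
  calc ∑ m ∈ F, |coordL ξ m y| = ∑ m ∈ F, |coordL ξ m (y - z)| := by
        refine Finset.sum_congr rfl fun m hm => ?_
        have : SchreierC00.coord z m = 0 := by
          refine Finsupp.notMem_support_iff.1 fun h => ?_
          exact absurd (hp h) (not_le.2 (hpF m hm))
        rw [map_sub, coordL_coe, this, sub_zero]
    _ ≤ ‖y - z‖ := sum_abs_coordL_le hF _
    _ ≤ ε := hz.le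

theorem coordL_basis (l m : ℕ+) : coordL ξ m (schreierBasis ξ l) = if l = m then 1 else 0 := by
  rw [schreierBasis, coordL_coe]
  exact Finsupp.single_apply

theorem coordL_eq_zero_of_mem {M : Set ℕ+} {y : SchreierSpace ξ} (hy : y ∈ SchreierSubspace ξ M)
    {m : ℕ+} (hm : m ∉ M) : coordL ξ m y = 0 := by
  have : SchreierSubspace ξ M ≤ LinearMap.ker (coordL ξ m : SchreierSpace ξ →ₗ[ℝ] ℝ) := by
    refine Submodule.topologicalClosure_minimal _ ?_ (coordL ξ m).isClosed_ker
    rw [Submodule.span_le]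
    rintro _ ⟨l, hl, rfl⟩
    have : l ≠ m := fun h => hm (h ▸ hl)
    simp [coordL_basis, this]
  exact this hy

/-- The canonical map from finitely supported sequences to the Schreier space. -/
def ofFinsupp (ξ : ℕ) : (ℕ+ →₀ ℝ) →ₗ[ℝ] SchreierSpace ξ :=
  Finsupp.linearCombination ℝ (schreierBasis ξ)

theorem coordL_ofFinsupp (m : ℕ+) (w : ℕ+ →₀ ℝ) : coordL ξ m (ofFinsupp ξ w) = w m := by
  have := Finsupp.apply_linearCombination ℝ (coordL ξ m : SchreierSpace ξ →ₗ[ℝ] ℝ)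
    (schreierBasis ξ) w
  refine this.trans ?_
  rw [Finsupp.linearCombination_apply]
  simp [Finsupp.sum, coordL_basis, eq_comm]

theorem sum_abs_le_norm_ofFinsupp {F : Finset ℕ+} (hF : F ∈ SchreierFamily ξ) (w : ℕ+ →₀ ℝ) :
    ∑ m ∈ F, |w m| ≤ ‖ofFinsupp ξ w‖ := by
  simpa only [coordL_ofFinsupp] using sum_abs_coordL_le hF (ofFinsupp ξ w)

theorem norm_ofFinsupp_le {w : ℕ+ →₀ ℝ} {c : ℝ}
    (h : ∀ F ∈ SchreierFamily ξ, ∑ m ∈ F, |w m| ≤ c) : ‖ofFinsupp ξ w‖ ≤ c :=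
  norm_le_of_sum_le fun F hF => by simpa only [coordL_ofFinsupp] using h F hF

theorem norm_ofFinsupp_le_of_abs_le {v w : ℕ+ →₀ ℝ} (h : ∀ m, |v m| ≤ |w m|) :
    ‖ofFinsupp ξ v‖ ≤ ‖ofFinsupp ξ w‖ :=
  norm_ofFinsupp_le fun _ hF =>
    (Finset.sum_le_sum fun m _ => h m).trans (sum_abs_le_norm_ofFinsupp hF w)

end

end SchreierSpace

/-! ### Convex combinations with small Schreier norm -/

/-- `w` is a system of convex weights supported on `B`. -/
structure IsConvexWeight (B : Finset ℕ+) (w : ℕ+ →₀ ℝ) : Prop where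
  support_subset : w.support ⊆ B
  nonneg : ∀ l, 0 ≤ w l
  sum_eq_one : ∑ l ∈ B, w l = 1

namespace IsConvexWeight

variable {B : Finset ℕ+} {w : ℕ+ →₀ ℝ}

theorem nonempty (h : IsConvexWeight B w) : B.Nonempty := by
  rw [Finset.nonempty_iff_ne_empty]
  rintro rfl
  simpa using h.sum_eq_one

theorem apply_eq_zero (h : IsConvexWeight B w) {l : ℕ+} (hl : l ∉ B) : w l = 0 :=
  Finsupp.notMem_support_iff.1 fun h' => hl (h.support_subset h')

theorem sum_eq_one_of_subset (h : IsConvexWeight B w) {D : Finset ℕ+} (hD : B ⊆ D) :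
    ∑ l ∈ D, w l = 1 := by
  rw [← h.sum_eq_one]
  exact (Finset.sum_subset hD fun l _ hl => h.apply_eq_zero hl).symm

theorem sum_abs_le_one (h : IsConvexWeight B w) (F : Finset ℕ+) : ∑ l ∈ F, |w l| ≤ 1 := by
  rw [← h.sum_eq_one_of_subset (D := B ∪ F) Finset.subset_union_left]
  simp_rw [abs_of_nonneg (h.nonneg _)]
  exact Finset.sum_le_sum_of_subset_of_nonneg Finset.subset_union_right fun l _ _ => h.nonneg l

theorem average {K : ℕ} (hK : 0 < K) {B : ℕ → Finset ℕ+} {w : ℕ → ℕ+ →₀ ℝ}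
    (h : ∀ k, IsConvexWeight (B k) (w k)) :
    IsConvexWeight ((Finset.range K).biUnion B) ((K : ℝ)⁻¹ • ∑ k ∈ Finset.range K, w k) where
  support_subset := by
    refine Finsupp.support_smul.trans (Finsupp.support_finsetSum.trans ?_)
    exact Finset.biUnion_mono fun k _ => (h k).support_subset
  nonneg l := by
    simp only [Finsupp.smul_apply, Finsupp.finsetSum_apply, smul_eq_mul]
    exact mul_nonneg (by positivity) (Finset.sum_nonneg fun k _ => (h k).nonneg l)
  sum_eq_one := by
    simp only [Finsupp.smul_apply, Finsupp.finsetSum_apply, smul_eq_mul]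
    rw [← Finset.mul_sum, Finset.sum_comm, Finset.sum_congr rfl fun k hk =>
      (h k).sum_eq_one_of_subset (Finset.subset_biUnion_of_mem B hk)]
    have : (K : ℝ) ≠ 0 := by positivity
    simp [this]

end IsConvexWeight

/-- There are convex weights supported in `N`, far out and on a member of `S_η`, whose images under
`V` have arbitrarily small norm of order `ζ`. -/
def HasSmallConvexWeights (V : (ℕ+ →₀ ℝ) →ₗ[ℝ] (ℕ+ → ℝ)) (N : Set ℕ+) (η ζ : ℕ) : Prop :=
  ∀ (n : ℕ+) (ε : ℝ), 0 < ε → ∃ B ∈ SchreierFamily η, ∃ w, IsConvexWeight B w ∧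
    (∀ l ∈ B, l ∈ N ∧ n ≤ l) ∧ ∀ F ∈ SchreierFamily ζ, ∑ m ∈ F, |V w m| ≤ ε

/-- A sum over a member of `S_{ζ+1}` of a sequence of functions, each of which is dominated on
tails and small in the norm of order `ζ` relative to where its predecessor ends. -/
theorem sum_sum_abs_le_of_successive {ζ K : ℕ} {C : ℝ} {y : ℕ → ℕ+ → ℝ} {p : ℕ → ℕ+}
    (hp : StrictMono p) (hK : 0 < K) (hC : 0 ≤ C)
    (hbdd : ∀ k, ∀ F ∈ SchreierFamily (ζ + 1), ∑ m ∈ F, |y k m| ≤ C)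
    (hsmall : ∀ k, ∀ F ∈ SchreierFamily ζ, ∑ m ∈ F, |y k m| ≤ (K * p k : ℝ)⁻¹)
    (htail : ∀ k, ∀ F ∈ SchreierFamily (ζ + 1), (∀ m ∈ F, p (k + 1) < m) →
      ∑ m ∈ F, |y k m| ≤ (K : ℝ)⁻¹)
    {F : Finset ℕ+} (hF : F ∈ SchreierFamily (ζ + 1)) :
    ∑ k ∈ Finset.range K, ∑ m ∈ F, |y k m| ≤ C + 1 := by
  have hK' : (0 : ℝ) < K := by exact_mod_cast hK
  rcases F.eq_empty_or_nonempty with rfl | hne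
  · simp
    linarith
  set a := F.min' hne with ha
  -- If `a = min F ≤ p k`, then `F` splits into at most `p k` members of `S_ζ`, on each of which `y
  -- k` is small. If `a > p (k + 1)`, only the tail of `y k` is seen. The remaining case costs `C`
  -- but occurs for at most one `k`.
  have key : ∀ k ∈ Finset.range K, ∑ m ∈ F, |y k m| ≤
      (K : ℝ)⁻¹ + if p k < a ∧ a ≤ p (k + 1) then C else 0 := by
    intro k _
    by_cases h1 : p k < a
    · by_cases h2 : a ≤ p (k + 1)
      · rw [if_pos ⟨h1, h2⟩]
        have : (0 : ℝ) < (K : ℝ)⁻¹ := by positivity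
        linarith [hbdd k F hF]
      · rw [if_neg (fun h => h2 h.2), add_zero]
        exact htail k F hF fun m hm => (not_le.1 h2).trans_le (F.min'_le m hm)
    · rw [if_neg (fun h => h1 h.1), add_zero]
      have hp0 : (0 : ℝ) < (p k : ℕ) := by exact_mod_cast (p k).pos
      have hap : ((a : ℕ) : ℝ) ≤ (p k : ℕ) := by exact_mod_cast not_lt.1 h1
      calc ∑ m ∈ F, |y k m| ≤ (a : ℕ) * (K * p k : ℝ)⁻¹ :=
            sum_le_of_mem_schreierFamily_succ hF (by positivity) (hsmall k)
              (F.min'_mem hne)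
        _ ≤ (p k : ℕ) * (K * p k : ℝ)⁻¹ := by gcongr
        _ = (K : ℝ)⁻¹ := by field_simp
  refine (Finset.sum_le_sum key).trans ?_
  rw [Finset.sum_add_distrib, ← Finset.sum_filter, Finset.sum_const, Finset.sum_const,
    Finset.card_range, nsmul_eq_mul, mul_inv_cancel₀ hK'.ne', nsmul_eq_mul]
  have hcard : ((Finset.range K).filter fun k => p k < a ∧ a ≤ p (k + 1)).card ≤ 1 := by
    refine Finset.card_le_one.2 fun i hi j hj => ?_
    simp only [Finset.mem_filter] at hi hj
    by_contra hij
    rcases lt_or_gt_of_ne hij with h | h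
    · exact absurd (hp.monotone (Nat.succ_le_of_lt h)) (not_le.2 (hj.2.1.trans_le hi.2.2))
    · exact absurd (hp.monotone (Nat.succ_le_of_lt h)) (not_le.2 (hi.2.1.trans_le hj.2.2))
  have : (((Finset.range K).filter fun k => p k < a ∧ a ≤ p (k + 1)).card : ℝ) ≤ 1 := by
    exact_mod_cast hcard
  nlinarith

/-- Averaging `K` successive weights raises both orders by one: the supports unite to a member of
`S_{η+1}`, while the images sum to at most `C + 1` on members of `S_{ζ+1}`, whatever `K` is. Each
weight is chosen small relative to the point `p` where the tail of its predecessor's image becomes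
negligible. -/
theorem HasSmallConvexWeights.succ {V : (ℕ+ →₀ ℝ) →ₗ[ℝ] (ℕ+ → ℝ)} {N : Set ℕ+} {η ζ : ℕ} {C : ℝ}
    (h : HasSmallConvexWeights V N η ζ) (hC : 0 ≤ C)
    (hbdd : ∀ B w, IsConvexWeight B w → (∀ l ∈ B, l ∈ N) →
      ∀ F ∈ SchreierFamily (ζ + 1), ∑ m ∈ F, |V w m| ≤ C)
    (htail : ∀ w, ∀ ε > 0, ∃ p : ℕ+, ∀ F ∈ SchreierFamily (ζ + 1), (∀ m ∈ F, p < m) →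
      ∑ m ∈ F, |V w m| ≤ ε) :
    HasSmallConvexWeights V N (η + 1) (ζ + 1) := by
  intro n ε hε
  obtain ⟨K, hKlarge⟩ := exists_nat_gt ((C + 1) / ε)
  have hK' : (0 : ℝ) < K := lt_of_le_of_lt (by positivity) hKlarge
  have hK : 0 < K := by exact_mod_cast hK'
  have hchoice : ∀ p : ℕ+, ∃ (B : Finset ℕ+) (w : ℕ+ →₀ ℝ) (q : ℕ+), B ∈ SchreierFamily η ∧
      IsConvexWeight B w ∧ (∀ l ∈ B, l ∈ N ∧ p < l ∧ l ≤ q) ∧ p < q ∧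
      (∀ F ∈ SchreierFamily ζ, ∑ m ∈ F, |V w m| ≤ (K * p : ℝ)⁻¹) ∧
      ∀ F ∈ SchreierFamily (ζ + 1), (∀ m ∈ F, q < m) → ∑ m ∈ F, |V w m| ≤ (K : ℝ)⁻¹ := by
    intro p
    have hp0 : (0 : ℝ) < (p : ℕ) := by exact_mod_cast p.pos
    obtain ⟨B, hB, w, hw, hBN, hsm⟩ := h (p + 1) (K * p : ℝ)⁻¹ (by positivity)
    obtain ⟨t, ht⟩ := htail w (K : ℝ)⁻¹ (by positivity)
    obtain ⟨b, hb⟩ := B.bddAbove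
    refine ⟨B, w, max (p + 1) (max t b), hB, hw, fun l hl => ⟨(hBN l hl).1, ?_, ?_⟩, ?_, hsm, ?_⟩
    · exact (PNat.lt_add_right p 1).trans_le (hBN l hl).2
    · exact (hb hl).trans (by simp)
    · exact (PNat.lt_add_right p 1).trans_le (le_max_left _ _)
    · exact fun F hF hm => ht F hF fun m hmF => lt_of_le_of_lt (by simp) (hm m hmF)
  choose B w q hBη hconv hBmem hpq hsm htl using hchoice
  -- Starting at or beyond `K` makes the union of `K` blocks admissible for `S_{η+1}`.
  set p : ℕ → ℕ+ := fun k => q^[k] (max n ⟨K, hK⟩) with hpdef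
  have hpsucc : ∀ k, p (k + 1) = q (p k) := fun k => Function.iterate_succ_apply' q k _
  have hpmono : StrictMono p := strictMono_nat_of_lt_succ fun k => by
    rw [hpsucc]
    exact hpq _
  have hp0 : ∀ k, max n ⟨K, hK⟩ ≤ p k := fun k => hpmono.monotone (Nat.zero_le k)
  refine ⟨(Finset.range K).biUnion fun k => B (p k), ?_,
    (K : ℝ)⁻¹ • ∑ k ∈ Finset.range K, w (p k), IsConvexWeight.average hK fun k => hconv (p k),
    ?_, ?_⟩
  · refine biUnion_range_mem_schreierFamily hK (fun k => hBη _) (fun k => (hconv _).nonempty) ?_ ?_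
    · intro i j hij a ha b hb
      calc a ≤ p (i + 1) := by
            rw [hpsucc]
            exact (hBmem _ a ha).2.2
        _ ≤ p j := hpmono.monotone hij
        _ < b := (hBmem _ b hb).2.1
    · intro a ha
      have h1 : (⟨K, hK⟩ : ℕ+) ≤ a :=
        ((le_max_right _ _).trans (hp0 0)).trans (hBmem _ a ha).2.1.le
      exact h1
  · intro l hl
    obtain ⟨k, -, hk⟩ := Finset.mem_biUnion.1 hl
    exact ⟨(hBmem _ l hk).1, ((le_max_left _ _).trans (hp0 k)).trans (hBmem _ l hk).2.1.le⟩
  · intro F hF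
    have hmain := sum_sum_abs_le_of_successive (y := fun k => V (w (p k))) hpmono hK hC
      (fun k => hbdd _ _ (hconv _) fun l hl => (hBmem _ l hl).1) (fun k => hsm _)
      (fun k => by rw [hpsucc]; exact htl _) hF
    calc ∑ m ∈ F, |V ((K : ℝ)⁻¹ • ∑ k ∈ Finset.range K, w (p k)) m|
        ≤ ∑ m ∈ F, (K : ℝ)⁻¹ * ∑ k ∈ Finset.range K, |V (w (p k)) m| := by
          refine Finset.sum_le_sum fun m _ => ?_
          rw [map_smul, map_sum, Pi.smul_apply, Finset.sum_apply, smul_eq_mul, abs_mul,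
            abs_of_pos (inv_pos.2 hK')]
          gcongr
          exact Finset.abs_sum_le_sum_abs _ _
      _ = (K : ℝ)⁻¹ * ∑ k ∈ Finset.range K, ∑ m ∈ F, |V (w (p k)) m| := by
          rw [← Finset.mul_sum, Finset.sum_comm]
      _ ≤ (K : ℝ)⁻¹ * (C + 1) := by gcongr
      _ ≤ ε := by
          rw [div_lt_iff₀ hε] at hKlarge
          rw [inv_mul_le_iff₀ hK']
          linarith

theorem IsConvexWeight.single (l : ℕ+) : IsConvexWeight {l} (Finsupp.single l 1) where
  support_subset := Finsupp.support_single_subset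
  nonneg m := by
    rw [Finsupp.single_apply]
    split_ifs <;> norm_num
  sum_eq_one := by simp

/-- The inclusion of finitely supported sequences into all sequences. -/
noncomputable def finsuppCoe : (ℕ+ →₀ ℝ) →ₗ[ℝ] (ℕ+ → ℝ) where
  toFun w := w
  map_add' _ _ := rfl
  map_smul' _ _ := rfl

/-- The base case averages `K` unit vectors lying beyond `K`; averaging again climbs the orders. -/
theorem hasSmallConvexWeights_finsuppCoe (ξ : ℕ) :
    HasSmallConvexWeights finsuppCoe Set.univ (ξ + 1) ξ := by
  induction ξ with
  | zero =>
    intro n ε hε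
    obtain ⟨K, hKlarge⟩ := exists_nat_gt (1 / ε)
    have hK' : (0 : ℝ) < K := lt_of_le_of_lt (by positivity) hKlarge
    have hK : 0 < K := by exact_mod_cast hK'
    set s : ℕ → ℕ+ := fun k => max n ⟨K, hK⟩ + ⟨k + 1, k.succ_pos⟩ with hs
    have hsinj : StrictMono s := fun i j hij => by
      refine add_lt_add_right (α := ℕ+) ?_ _
      exact Nat.succ_lt_succ hij
    have hge : ∀ k, max n ⟨K, hK⟩ ≤ s k := fun k => (PNat.lt_add_right _ _).le
    refine ⟨(Finset.range K).biUnion fun k => {s k}, ?_,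
      (K : ℝ)⁻¹ • ∑ k ∈ Finset.range K, Finsupp.single (s k) 1,
      IsConvexWeight.average hK fun k => IsConvexWeight.single (s k), ?_, ?_⟩
    · refine biUnion_range_mem_schreierFamily hK (fun k => Or.inr ⟨_, rfl⟩)
        (fun k => Finset.singleton_nonempty _) ?_ ?_
      · intro i j hij a ha b hb
        rw [Finset.mem_singleton] at ha hb
        subst ha hb
        exact hsinj hij
      · intro a ha
        rw [Finset.mem_singleton] at ha
        subst ha
        have : (⟨K, hK⟩ : ℕ+) ≤ s 0 := (le_max_right _ _).trans (hge 0)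
        exact this
    · intro l hl
      obtain ⟨k, -, hk⟩ := Finset.mem_biUnion.1 hl
      rw [Finset.mem_singleton] at hk
      subst hk
      exact ⟨trivial, (le_max_left _ _).trans (hge k)⟩
    · have hle : ∀ m : ℕ+, ∑ k ∈ Finset.range K, Finsupp.single (s k) (1 : ℝ) m ≤ 1 := by
        intro m
        simp only [Finsupp.single_apply]
        rw [← Finset.sum_filter, Finset.sum_const, nsmul_eq_mul, mul_one]
        have : ((Finset.range K).filter fun k => s k = m).card ≤ 1 := by
          refine Finset.card_le_one.2 fun i hi j hj => ?_
          simp only [Finset.mem_filter] at hi hj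
          exact hsinj.injective (hi.2.trans hj.2.symm)
        exact_mod_cast this
      rintro F (rfl | ⟨m, rfl⟩)
      · simpa using hε.le
      · have hw := IsConvexWeight.average hK fun k => IsConvexWeight.single (s k)
        rw [Finset.sum_singleton]
        change |((K : ℝ)⁻¹ • ∑ k ∈ Finset.range K, Finsupp.single (s k) (1 : ℝ)) m| ≤ ε
        rw [abs_of_nonneg (hw.nonneg m)]
        simp only [Finsupp.smul_apply, Finsupp.finsetSum_apply, smul_eq_mul]
        rw [inv_mul_le_iff₀ hK']
        rw [div_lt_iff₀ hε] at hKlarge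
        linarith [hle m]
  | succ ξ ih =>
    refine ih.succ zero_le_one (fun B w hw _ F _ => hw.sum_abs_le_one F) fun w ε hε => ?_
    obtain ⟨p, hp⟩ := w.support.bddAbove
    refine ⟨p, fun F _ hF => ?_⟩
    rw [Finset.sum_eq_zero]
    · exact hε.le
    · intro m hm
      have : w m = 0 := Finsupp.notMem_support_iff.1 fun h => absurd (hp h) (not_le.2 (hF m hm))
      exact abs_eq_zero.2 this

/-! ### Choosing signs -/

/-- A quadratic form takes, at some vector of signs, a value at least its trace. -/
theorem exists_sign_trace_le {ι : Type*} [DecidableEq ι] (D : Finset ι) (A : ι → ι → ℝ) :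
    ∃ θ : ι → ℝ, (∀ i, |θ i| = 1) ∧
      ∑ i ∈ D, A i i ≤ ∑ i ∈ D, ∑ j ∈ D, θ i * (θ j * A i j) := by
  induction D using Finset.induction_on with
  | empty => exact ⟨fun _ => 1, by simp, by simp⟩
  | insert x D hx ih =>
    obtain ⟨θ, hθ, hle⟩ := ih
    -- The cross terms of the new index contribute `σ * r`, so `σ` is the sign making this
    -- nonnegative; the new diagonal term is unaffected since `σ * σ = 1`.
    set r : ℝ := ∑ i ∈ D, θ i * (A x i + A i x) with hr
    obtain ⟨σ, hσ, hσr⟩ : ∃ σ : ℝ, |σ| = 1 ∧ 0 ≤ σ * r := by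
      rcases le_total 0 r with h | h
      · exact ⟨1, by simp, by simpa using h⟩
      · exact ⟨-1, by simp, by simpa using h⟩
    have hσ2 : σ * σ = 1 := by rw [← abs_mul_abs_self, hσ, one_mul]
    refine ⟨Function.update θ x σ, fun i => ?_, ?_⟩
    · rcases eq_or_ne i x with rfl | hi
      · simpa using hσ
      · simpa [hi] using hθ i
    · have hne : ∀ i ∈ D, Function.update θ x σ i = θ i := fun i hi =>
        Function.update_of_ne (ne_of_mem_of_not_mem hi hx) _ _
      rw [Finset.sum_insert hx, Finset.sum_insert hx, Finset.sum_insert hx]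
      have e1 : ∑ j ∈ D, Function.update θ x σ x * (Function.update θ x σ j * A x j) =
          σ * ∑ j ∈ D, θ j * A x j := by
        rw [Finset.mul_sum]
        refine Finset.sum_congr rfl fun j hj => ?_
        rw [hne j hj, Function.update_self]
      have e2 : ∑ i ∈ D, ∑ j ∈ insert x D,
          Function.update θ x σ i * (Function.update θ x σ j * A i j) =
          σ * ∑ i ∈ D, θ i * A i x + ∑ i ∈ D, ∑ j ∈ D, θ i * (θ j * A i j) := by
        rw [Finset.mul_sum, ← Finset.sum_add_distrib]
        refine Finset.sum_congr rfl fun i hi => ?_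
        rw [Finset.sum_insert hx, hne i hi, Function.update_self]
        congr 1
        · ring
        · exact Finset.sum_congr rfl fun j hj => by rw [hne j hj]
      rw [e1, e2, Function.update_self]
      have e3 : σ * r = σ * ∑ j ∈ D, θ j * A x j + σ * ∑ i ∈ D, θ i * A i x := by
        rw [hr, ← mul_add, ← Finset.sum_add_distrib]
        simp_rw [mul_add]
      have e4 : σ * (σ * A x x) = A x x := by rw [← mul_assoc, hσ2, one_mul]
      linarith

/-! ### Images of the unit vectors under an embedding -/

namespace SchreierSpace

open Finset in
/-- If the vectors `y l`, `l ∈ G`, have large coordinates at places forming a member of `S_ξ`, then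
nonnegative combinations of unit vectors over `G` dominate the `ℓ₁`-norm. -/
theorem mul_sum_le_of_large_coord {ξ : ℕ} {L : Set ℕ+} {y : ℕ+ → SchreierSpace ξ} {C δ : ℝ}
    (hC : 0 ≤ C)
    (hy : ∀ w : ℕ+ →₀ ℝ, (∀ l ∈ w.support, l ∈ L) →
      ‖Finsupp.linearCombination ℝ y w‖ ≤ C * ‖ofFinsupp ξ w‖)
    {w : ℕ+ →₀ ℝ} (hw : ∀ l, 0 ≤ w l) {G D : Finset ℕ+} (hG : ∀ l ∈ G, l ∈ L)
    (hD : D ∈ SchreierFamily ξ) {μ : ℕ+ → ℕ+} (hμ : ∀ l ∈ G, μ l ∈ D)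
    (hδ : ∀ l ∈ G, δ ≤ |coordL ξ (μ l) (y l)|) :
    δ * ∑ l ∈ G, w l ≤ C * ‖ofFinsupp ξ w‖ := by
  set s : ℕ+ → ℝ := fun l => SignType.sign (coordL ξ (μ l) (y l)) with hs
  -- The trace of `A` collects the large coordinates. The signs `θ` serve twice: on the test
  -- coordinates `i ∈ D` and, through `μ`, on the coefficients of `x`. Thus `μ` need not be
  -- injective.
  set A : ℕ+ → ℕ+ → ℝ := fun i j => ∑ l ∈ G with μ l = j, s l * w l * coordL ξ i (y l) with hA
  obtain ⟨θ, hθ, htr⟩ := exists_sign_trace_le D A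
  set x : ℕ+ →₀ ℝ := ∑ l ∈ G, Finsupp.single l (θ (μ l) * (s l * w l)) with hx
  have hxapp : ∀ m, x m = if m ∈ G then θ (μ m) * (s m * w m) else 0 := fun m => by
    simp [hx, Finsupp.finsetSum_apply, Finsupp.single_apply]
  have hs1 : ∀ l, |s l| ≤ 1 := fun l => by
    simp only [hs]
    rcases lt_trichotomy (coordL ξ (μ l) (y l)) 0 with h | h | h <;> simp [h]
  have hxle : ∀ m, |x m| ≤ |w m| := fun m => by
    rw [hxapp]
    split_ifs
    · rw [abs_mul, hθ, one_mul, abs_mul]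
      exact mul_le_of_le_one_left (abs_nonneg _) (hs1 m)
    · simp
  have hxL : ∀ l ∈ x.support, l ∈ L := fun l hl => by
    refine hG l ?_
    by_contra h
    exact Finsupp.mem_support_iff.1 hl (by rw [hxapp, if_neg h])
  have hcoord : ∀ i, coordL ξ i (Finsupp.linearCombination ℝ y x) = ∑ j ∈ D, θ j * A i j := by
    intro i
    rw [hx, map_sum, map_sum, ← sum_fiberwise_of_maps_to hμ]
    refine sum_congr rfl fun j _ => ?_
    rw [hA, mul_sum]
    refine sum_congr rfl fun l hl => ?_
    rw [Finsupp.linearCombination_single, map_smul, (mem_filter.1 hl).2, smul_eq_mul]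
    ring
  have hdiag : δ * ∑ l ∈ G, w l ≤ ∑ j ∈ D, A j j := by
    rw [← sum_fiberwise_of_maps_to hμ, mul_sum]
    refine sum_le_sum fun j _ => ?_
    rw [mul_sum]
    refine sum_le_sum fun l hl => ?_
    obtain ⟨hlG, rfl⟩ := mem_filter.1 hl
    calc δ * w l ≤ |coordL ξ (μ l) (y l)| * w l :=
          mul_le_mul_of_nonneg_right (hδ l hlG) (hw l)
      _ = s l * w l * coordL ξ (μ l) (y l) := by
          rw [← sign_mul_self]
          ring
  calc δ * ∑ l ∈ G, w l ≤ ∑ i ∈ D, ∑ j ∈ D, θ i * (θ j * A i j) := hdiag.trans htr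
    _ ≤ ∑ i ∈ D, |coordL ξ i (Finsupp.linearCombination ℝ y x)| := by
        refine sum_le_sum fun i _ => ?_
        rw [← mul_sum, ← hcoord]
        refine (le_abs_self _).trans ?_
        rw [abs_mul, hθ, one_mul]
    _ ≤ ‖Finsupp.linearCombination ℝ y x‖ := sum_abs_coordL_le hD _
    _ ≤ C * ‖ofFinsupp ξ x‖ := hy x hxL
    _ ≤ C * ‖ofFinsupp ξ w‖ := by
        gcongr
        exact norm_ofFinsupp_le_of_abs_le hxle

/-- Under an isomorphic embedding, the images of far out unit vectors have a coordinate bounded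
away from zero. -/
theorem exists_large_coord {ξ : ℕ} {L : Set ℕ+} {y : ℕ+ → SchreierSpace ξ} {c C : ℝ}
    (hc : 0 < c) (hC : 0 ≤ C)
    (hupper : ∀ w : ℕ+ →₀ ℝ, (∀ l ∈ w.support, l ∈ L) →
      ‖Finsupp.linearCombination ℝ y w‖ ≤ C * ‖ofFinsupp ξ w‖)
    (hlower : ∀ w : ℕ+ →₀ ℝ, (∀ l ∈ w.support, l ∈ L) →
      c * ‖ofFinsupp ξ w‖ ≤ ‖Finsupp.linearCombination ℝ y w‖) :
    ∃ δ > 0, ∃ n : ℕ+, ∀ l ∈ L, n ≤ l → ∃ m, δ < |coordL ξ m (y l)| := by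
  by_contra! hcon
  set V : (ℕ+ →₀ ℝ) →ₗ[ℝ] (ℕ+ → ℝ) :=
    LinearMap.pi fun m => (coordL ξ m : SchreierSpace ξ →ₗ[ℝ] ℝ) ∘ₗ Finsupp.linearCombination ℝ y
    with hV
  have hVapp : ∀ w m, V w m = coordL ξ m (Finsupp.linearCombination ℝ y w) := fun _ _ => rfl
  have key : ∀ ζ ≤ ξ, HasSmallConvexWeights V L ζ ζ := by
    intro ζ
    induction ζ with
    | zero =>
      intro _ n ε hε
      obtain ⟨l, hl, hnl, hm⟩ := hcon ε hε n
      refine ⟨{l}, Or.inr ⟨l, rfl⟩, Finsupp.single l 1, IsConvexWeight.single l, ?_, ?_⟩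
      · simpa using ⟨hl, hnl⟩
      · rintro F (rfl | ⟨m, rfl⟩)
        · simpa using hε.le
        · simpa [hVapp] using hm m
    | succ ζ ih =>
      intro hζ
      have hsub := schreierFamily_mono hζ
      refine (ih (by omega)).succ hC (fun B w hw hB F hF => ?_) fun w ε hε => ?_
      · calc ∑ m ∈ F, |V w m| ≤ ‖Finsupp.linearCombination ℝ y w‖ := sum_abs_coordL_le (hsub hF) _
          _ ≤ C * ‖ofFinsupp ξ w‖ := hupper w fun l hl => hB l (hw.support_subset hl)
          _ ≤ C * 1 := by
              gcongr
              exact norm_ofFinsupp_le fun F _ => hw.sum_abs_le_one F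
          _ = C := mul_one C
      · obtain ⟨p, hp⟩ := exists_tail_le (Finsupp.linearCombination ℝ y w) hε
        exact ⟨p, fun F hF h => hp F (hsub hF) h⟩
  -- Since `B ∈ S_ξ`, the norm of `w` is at least 1, so an image of norm at most `c / 2` violates
  -- the lower estimate.
  obtain ⟨B, hB, w, hw, hBL, hsm⟩ := key ξ le_rfl 1 (c / 2) (half_pos hc)
  have h1 : 1 ≤ ‖ofFinsupp ξ w‖ := by
    rw [← hw.sum_eq_one]
    exact (Finset.sum_le_sum fun l _ => le_abs_self (w l)).trans (sum_abs_le_norm_ofFinsupp hB w)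
  have h2 : ‖Finsupp.linearCombination ℝ y w‖ ≤ c / 2 := norm_le_of_sum_le hsm
  have h3 := hlower w fun l hl => (hBL l (hw.support_subset hl)).1
  nlinarith

/-- If `y` comes from an embedding into the span over a set without elements in `[q, max B]`, then
convex weights on `B` cannot have too small a norm. -/
theorem le_norm_of_gap {ξ : ℕ} (hξ : 1 ≤ ξ) {L M : Set ℕ+} {y : ℕ+ → SchreierSpace ξ} {C δ : ℝ}
    (hC : 0 ≤ C)
    (hy : ∀ w : ℕ+ →₀ ℝ, (∀ l ∈ w.support, l ∈ L) →
      ‖Finsupp.linearCombination ℝ y w‖ ≤ C * ‖ofFinsupp ξ w‖)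
    {B : Finset ℕ+} {w : ℕ+ →₀ ℝ} (hw : IsConvexWeight B w) (hBL : ∀ l ∈ B, l ∈ L)
    {μ : ℕ+ → ℕ+} (hμM : ∀ l ∈ B, μ l ∈ M) (hδ : ∀ l ∈ B, δ ≤ |coordL ξ (μ l) (y l)|)
    {q r : ℕ+} (hBr : ∀ l ∈ B, l ≤ r) (hM : ∀ m ∈ M, m < q ∨ r < m) :
    δ ≤ (q + 1) * (C * ‖ofFinsupp ξ w‖) := by
  set a : ℝ := C * ‖ofFinsupp ξ w‖ with ha
  have ha0 : 0 ≤ a := by positivity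
  have hlow : ∀ m, δ * ∑ l ∈ B with μ l = m, w l ≤ a := fun m =>
    mul_sum_le_of_large_coord hC hy hw.nonneg (D := {m}) (μ := μ)
      (fun l hl => hBL l (Finset.mem_filter.1 hl).1) (singleton_mem_schreierFamily ξ m)
      (fun l hl => Finset.mem_singleton.2 (Finset.mem_filter.1 hl).2)
      (fun l hl => hδ l (Finset.mem_filter.1 hl).1)
  have hhigh : δ * ∑ l ∈ B with ¬ μ l < q, w l ≤ a := by
    refine mul_sum_le_of_large_coord hC hy hw.nonneg (D := {l ∈ B | ¬ μ l < q}.image μ) (μ := μ)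
      (fun l hl => hBL l (Finset.mem_filter.1 hl).1)
      (schreierFamily_mono hξ (mem_schreierFamily_one ?_))
      (fun l hl => Finset.mem_image_of_mem μ hl) (fun l hl => hδ l (Finset.mem_filter.1 hl).1)
    intro m hm
    obtain ⟨l, hl, rfl⟩ := Finset.mem_image.1 hm
    rw [Finset.mem_filter] at hl
    have hr : r < μ l := (hM _ (hμM l hl.1)).resolve_left hl.2
    have hcard : B.card ≤ (r : ℕ) := by
      -- The places beyond the gap exceed `r`, while `B ⊆ [1, r]` bounds their number by `r`.
      calc B.card ≤ (Finset.Icc 1 r).card :=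
            Finset.card_le_card fun l hl => Finset.mem_Icc.2 ⟨one_le, hBr l hl⟩
        _ = r := by simp
    calc _ ≤ B.card := Finset.card_image_le.trans (Finset.card_filter_le _ _)
      _ ≤ (r : ℕ) := hcard
      _ ≤ (μ l : ℕ) := PNat.coe_le_coe _ _ |>.2 hr.le
  have hsplit : ∑ l ∈ B with μ l < q, w l = ∑ m ∈ Finset.Icc 1 q, ∑ l ∈ B with μ l < q ∧ μ l = m,
      w l := by
    simp_rw [← Finset.filter_filter]
    refine (Finset.sum_fiberwise_of_maps_to (fun l hl => ?_) _).symm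
    exact Finset.mem_Icc.2 ⟨one_le, (Finset.mem_filter.1 hl).2.le⟩
  have hlow' : δ * ∑ l ∈ B with μ l < q, w l ≤ q * a := by
    rw [hsplit, Finset.mul_sum]
    refine (Finset.sum_le_sum (g := fun _ => a) fun m _ => ?_).trans (by simp)
    by_cases hmq : m < q
    · have : ∀ l, (μ l < q ∧ μ l = m) ↔ μ l = m :=
        fun l => ⟨fun h => h.2, fun h => ⟨h ▸ hmq, h⟩⟩
      simp_rw [this]
      exact hlow m
    · rw [Finset.sum_eq_zero]
      · simpa using ha0
      · intro l hl
        obtain ⟨-, h1, rfl⟩ := Finset.mem_filter.1 hl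
        exact absurd h1 hmq
  calc δ = δ * ∑ l ∈ B, w l := by rw [hw.sum_eq_one, mul_one]
    _ = δ * ∑ l ∈ B with μ l < q, w l + δ * ∑ l ∈ B with ¬ μ l < q, w l := by
        rw [← mul_add, Finset.sum_filter_add_sum_filter_not]
    _ ≤ (q + 1) * a := by linarith

/-- An isomorphic embedding is given by a linear map with two-sided norm estimates. -/
theorem _root_.EmbedsIsomorphically.exists_linearMap {X Y : Type*} [NormedAddCommGroup X]
    [NormedSpace ℝ X] [NormedAddCommGroup Y] [NormedSpace ℝ Y] (h : EmbedsIsomorphically X Y) :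
    ∃ (S : X →ₗ[ℝ] Y) (c C : ℝ), 0 < c ∧ 0 ≤ C ∧ (∀ x, ‖S x‖ ≤ C * ‖x‖) ∧
      ∀ x, c * ‖x‖ ≤ ‖S x‖ := by
  obtain ⟨Z, -, ⟨T⟩⟩ := h
  have hK0 := norm_nonneg (T.symm : Z →L[ℝ] X)
  -- `K` may vanish when the space is trivial, hence the constant `(K + 1)⁻¹`.
  set K := ‖(T.symm : Z →L[ℝ] X)‖ with hK
  refine ⟨Z.subtype ∘ₗ (T : X →ₗ[ℝ] Z), (K + 1)⁻¹, ‖(T : X →L[ℝ] Z)‖, by positivity,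
    norm_nonneg (T : X →L[ℝ] Z), (T : X →L[ℝ] Z).le_opNorm, fun x => ?_⟩
  change (K + 1)⁻¹ * ‖x‖ ≤ ‖T x‖
  rw [inv_mul_le_iff₀ (by positivity)]
  have := (T.symm : Z →L[ℝ] X).le_opNorm (T x)
  simp only [ContinuousLinearEquiv.coe_coe, ContinuousLinearEquiv.symm_apply_apply] at this
  nlinarith [norm_nonneg (T x)]

/-- An isomorphic embedding of `X_L` into `X_M`, expressed through the images of the unit
vectors. -/
theorem exists_images_of_embeds {ξ : ℕ} {L M : Set ℕ+}
    (h : EmbedsIsomorphically (SchreierSubspace ξ L) (SchreierSubspace ξ M)) :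
    ∃ (y : ℕ+ → SchreierSpace ξ) (c C : ℝ), 0 < c ∧ 0 ≤ C ∧ (∀ l, y l ∈ SchreierSubspace ξ M) ∧
      (∀ w : ℕ+ →₀ ℝ, (∀ l ∈ w.support, l ∈ L) →
        ‖Finsupp.linearCombination ℝ y w‖ ≤ C * ‖ofFinsupp ξ w‖) ∧
      ∀ w : ℕ+ →₀ ℝ, (∀ l ∈ w.support, l ∈ L) →
        c * ‖ofFinsupp ξ w‖ ≤ ‖Finsupp.linearCombination ℝ y w‖ := by
  classical
  obtain ⟨T, c, C, hc, hC, hup, hlow⟩ := h.exists_linearMap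
  have hmem : ∀ l ∈ L, schreierBasis ξ l ∈ SchreierSubspace ξ L := fun l hl =>
    Submodule.le_topologicalClosure _ (Submodule.subset_span ⟨l, hl, rfl⟩)
  -- The value 0 off `L` is harmless: the norm estimates only concern `w` supported in `L`.
  set e : ℕ+ → SchreierSubspace ξ L := fun l =>
    if hl : l ∈ L then ⟨schreierBasis ξ l, hmem l hl⟩ else 0 with he
  set S : SchreierSubspace ξ L →ₗ[ℝ] SchreierSpace ξ :=
    (SchreierSubspace ξ M).subtype ∘ₗ T with hS
  have hSnorm : ∀ x, ‖S x‖ = ‖T x‖ := fun _ => rfl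
  have hy : ∀ w, Finsupp.linearCombination ℝ (fun l => S (e l)) w =
      S (Finsupp.linearCombination ℝ e w) := fun w => (Finsupp.apply_linearCombination ℝ S e w).symm
  have hcoe : ∀ w : ℕ+ →₀ ℝ, (∀ l ∈ w.support, l ∈ L) →
      ‖Finsupp.linearCombination ℝ e w‖ = ‖ofFinsupp ξ w‖ := by
    intro w hw
    have h1 : ((Finsupp.linearCombination ℝ e w : SchreierSubspace ξ L) : SchreierSpace ξ) =
        ofFinsupp ξ w := by
      have := Finsupp.apply_linearCombination ℝ (SchreierSubspace ξ L).subtype e w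
      refine this.trans ?_
      rw [ofFinsupp, Finsupp.linearCombination_apply, Finsupp.linearCombination_apply]
      refine Finset.sum_congr rfl fun l hl => ?_
      simp [he, hw l hl]
    rw [← h1]
    rfl
  refine ⟨fun l => S (e l), c, C, hc, hC, fun l => (T (e l)).2, fun w hw => ?_, fun w hw => ?_⟩
  · rw [hy, hSnorm, ← hcoe w hw]
    exact hup _
  · rw [hy, hSnorm, ← hcoe w hw]
    exact hlow _

end SchreierSpace

/-! ### Block sets -/

/-- Successive blocks carrying convex weights of rapidly decreasing norm. -/
structure IsThinBlocks (ξ : ℕ) (B : ℕ → Finset ℕ+) (w : ℕ → ℕ+ →₀ ℝ) (q : ℕ → ℕ+) : Prop where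
  strictMono : StrictMono q
  isConvexWeight : ∀ j, IsConvexWeight (B j) (w j)
  mem : ∀ j, ∀ l ∈ B j, q j < l ∧ l ≤ q (j + 1)
  norm_le : ∀ j, ‖SchreierSpace.ofFinsupp ξ (w j)‖ ≤ (((q j : ℕ) + 2) * (j + 1) : ℝ)⁻¹

/-- In the norm bound, `q j + 2` cancels the constant of `le_norm_of_gap`, applied with `q j + 1`;
the factor `j + 1` makes the result tend to 0. -/
theorem exists_isThinBlocks (ξ : ℕ) : ∃ B w q, IsThinBlocks ξ B w q := by
  have hstep : ∀ (j : ℕ) (p : ℕ+), ∃ (B : Finset ℕ+) (w : ℕ+ →₀ ℝ) (r : ℕ+), IsConvexWeight B w ∧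
      (∀ l ∈ B, p < l ∧ l ≤ r) ∧ p < r ∧
      ‖SchreierSpace.ofFinsupp ξ w‖ ≤ (((p : ℕ) + 2) * (j + 1) : ℝ)⁻¹ := by
    intro j p
    obtain ⟨B, -, w, hw, hB, hsm⟩ := hasSmallConvexWeights_finsuppCoe ξ (p + 1)
      (((p : ℕ) + 2) * (j + 1) : ℝ)⁻¹ (by positivity)
    obtain ⟨b, hb⟩ := B.bddAbove
    refine ⟨B, w, max (p + 1) b, hw, fun l hl => ⟨?_, (hb hl).trans (le_max_right _ _)⟩, ?_,
      SchreierSpace.norm_ofFinsupp_le hsm⟩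
    · exact (PNat.lt_add_right p 1).trans_le (hB l hl).2
    · exact (PNat.lt_add_right p 1).trans_le (le_max_left _ _)
  choose B w r hw hB hr hn using hstep
  set q : ℕ → ℕ+ := fun j => Nat.rec 1 (fun i p => r i p) j with hq
  exact ⟨fun j => B j (q j), fun j => w j (q j), q, strictMono_nat_of_lt_succ fun j => hr j (q j),
    fun j => hw j _, fun j => hB j _, fun j => hn j _⟩

/-- The union of the blocks with index in `I`. -/
def blockUnion (B : ℕ → Finset ℕ+) (I : Set ℕ) : Set ℕ+ := {l | ∃ j ∈ I, l ∈ B j}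

namespace IsThinBlocks

variable {ξ : ℕ} {B : ℕ → Finset ℕ+} {w : ℕ → ℕ+ →₀ ℝ} {q : ℕ → ℕ+}

theorem lt_or_lt_of_mem_ne (h : IsThinBlocks ξ B w q) {j k : ℕ} (hjk : k ≠ j) {m : ℕ+}
    (hm : m ∈ B k) : m < q j + 1 ∨ q (j + 1) < m := by
  rcases lt_or_gt_of_ne hjk with hlt | hgt
  · exact Or.inl (PNat.lt_add_one_iff.2
      ((h.mem k m hm).2.trans (h.strictMono.monotone (Nat.succ_le_of_lt hlt))))
  · exact Or.inr ((h.strictMono.monotone (Nat.succ_le_of_lt hgt)).trans_lt (h.mem k m hm).1)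

theorem mem_iff_of_mem (h : IsThinBlocks ξ B w q) {I : Set ℕ} {j : ℕ} {l : ℕ+} (hl : l ∈ B j) :
    l ∈ blockUnion B I ↔ j ∈ I := by
  refine ⟨fun ⟨k, hk, hlk⟩ => ?_, fun hj => ⟨j, hj, hl⟩⟩
  by_contra hj
  have hne : k ≠ j := fun e => hj (e ▸ hk)
  rcases h.lt_or_lt_of_mem_ne hne hlk with h1 | h1
  · exact absurd (PNat.lt_add_one_iff.1 h1) (not_le.2 (h.mem j l hl).1)
  · exact absurd h1 (not_lt.2 (h.mem j l hl).2)

theorem blockUnion_injective (h : IsThinBlocks ξ B w q) : Function.Injective (blockUnion B) := by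
  intro I J hIJ
  ext j
  obtain ⟨l, hl⟩ := (h.isConvexWeight j).nonempty
  rw [← h.mem_iff_of_mem hl, hIJ, h.mem_iff_of_mem hl]

theorem blockUnion_infinite (h : IsThinBlocks ξ B w q) {I : Set ℕ} (hI : I.Infinite) :
    (blockUnion B I).Infinite := by
  choose f hf using fun j => (h.isConvexWeight j).nonempty
  have hinj : Function.Injective f := by
    intro i j hij
    have := (h.mem_iff_of_mem (I := {j}) (hf i)).1 ((h.mem_iff_of_mem (hij ▸ hf j)).2 rfl)
    exact this
  refine (hI.image hinj.injOn).mono ?_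
  rintro _ ⟨j, hj, rfl⟩
  exact ⟨j, hj, hf j⟩

theorem not_embeds (h : IsThinBlocks ξ B w q) (hξ : 1 ≤ ξ) {I J : Set ℕ} (hIJ : (I \ J).Infinite) :
    ¬ EmbedsIsomorphically (SchreierSubspace ξ (blockUnion B I))
      (SchreierSubspace ξ (blockUnion B J)) := by
  intro hemb
  obtain ⟨y, c, C, hc, hC, hyM, hupper, hlower⟩ := SchreierSpace.exists_images_of_embeds hemb
  obtain ⟨δ, hδ, n, hn⟩ := SchreierSpace.exists_large_coord hc hC hupper hlower
  obtain ⟨K, hK⟩ := exists_nat_gt (C / δ)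
  obtain ⟨j, ⟨hjI, hjJ⟩, hj⟩ := hIJ.exists_gt (max K n)
  have hBI : ∀ l ∈ B j, l ∈ blockUnion B I := fun l hl => ⟨j, hjI, hl⟩
  have hge : ∀ l ∈ B j, n ≤ l := by
    intro l hl
    have h1 : j ≤ (q j : ℕ) :=
      (show StrictMono fun j => (q j : ℕ) from fun a b hab => h.strictMono hab).le_apply
    have h2 : (q j : ℕ) < l := (h.mem j l hl).1
    have h3 : (n : ℕ) ≤ (l : ℕ) := by omega
    exact h3
  have hμ : ∀ l, ∃ m, l ∈ B j → δ < |SchreierSpace.coordL ξ m (y l)| := by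
    intro l
    by_cases hl : l ∈ B j
    · obtain ⟨m, hm⟩ := hn l (hBI l hl) (hge l hl)
      exact ⟨m, fun _ => hm⟩
    · exact ⟨1, fun h' => absurd h' hl⟩
  choose μ hμ using hμ
  have hμM : ∀ l ∈ B j, μ l ∈ blockUnion B J := by
    intro l hl
    by_contra hm
    have := hμ l hl
    rw [SchreierSpace.coordL_eq_zero_of_mem (hyM l) hm, abs_zero] at this
    linarith
  have hmain := SchreierSpace.le_norm_of_gap hξ hC hupper (h.isConvexWeight j) hBI hμM
    (fun l hl => (hμ l hl).le) (q := q j + 1) (r := q (j + 1)) (fun l hl => (h.mem j l hl).2)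
    (by
      rintro m ⟨k, hk, hm⟩
      exact h.lt_or_lt_of_mem_ne (ne_of_mem_of_not_mem hk hjJ) hm)
  have hj' : (K : ℝ) < j + 1 := by
    have : K < j + 1 := by omega
    exact_mod_cast this
  have hbound : δ ≤ C / (j + 1) := by
    calc δ ≤ (((q j + 1 : ℕ+) : ℕ) + 1 : ℝ) * (C * ‖SchreierSpace.ofFinsupp ξ (w j)‖) := hmain
      _ ≤ (((q j + 1 : ℕ+) : ℕ) + 1 : ℝ) * (C * (((q j : ℕ) + 2) * (j + 1) : ℝ)⁻¹) := by
          gcongr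
          exact h.norm_le j
      _ = C / (j + 1) := by
          push_cast
          have : ((q j : ℕ) : ℝ) + 2 ≠ 0 := by positivity
          field_simp
          ring
  rw [le_div_iff₀ (by positivity)] at hbound
  rw [div_lt_iff₀ hδ] at hK
  nlinarith

end IsThinBlocks

/-! ### An almost disjoint family -/

/-- The set of codes of the initial segments of `f`. -/
def initialSegmentCodes (f : ℕ → Bool) : Set ℕ :=
  Set.range fun n => Encodable.encode ((List.range n).map f)

theorem encode_initialSegment_inj {f g : ℕ → Bool} {m n : ℕ}
    (h : Encodable.encode ((List.range m).map f) = Encodable.encode ((List.range n).map g)) :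
    m = n ∧ ∀ k < m, f k = g k := by
  have h1 := Encodable.encode_injective h
  have h2 : m = n := by simpa using congrArg List.length h1
  subst h2
  refine ⟨rfl, fun k hk => ?_⟩
  have := List.map_inj_left.1 h1
  exact this k (List.mem_range.2 hk)

theorem infinite_initialSegmentCodes (f : ℕ → Bool) : (initialSegmentCodes f).Infinite :=
  Set.infinite_range_of_injective fun _ _ h => (encode_initialSegment_inj h).1

/-- Once `f` and `g` differ at `k`, no initial segment of `f` longer than `k` is one of `g`. -/
theorem infinite_initialSegmentCodes_diff {f g : ℕ → Bool} (hfg : f ≠ g) :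
    (initialSegmentCodes f \ initialSegmentCodes g).Infinite := by
  obtain ⟨k, hk⟩ := Function.ne_iff.1 hfg
  refine (Set.infinite_range_of_injective (f := fun n =>
    Encodable.encode ((List.range (k + 1 + n)).map f)) fun a b h => ?_).mono ?_
  · have := (encode_initialSegment_inj h).1
    omega
  · rintro _ ⟨n, rfl⟩
    refine ⟨⟨_, rfl⟩, ?_⟩
    rintro ⟨m, hm⟩
    exact hk ((encode_initialSegment_inj hm.symm).2 k (by omega))

theorem initialSegmentCodes_injective : Function.Injective initialSegmentCodes := by
  intro f g h
  by_contra hfg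
  have := infinite_initialSegmentCodes_diff hfg
  simp [h] at this

theorem theorem2 (ξ : ℕ) (hξ : 1 ≤ ξ) :
    ∃ 𝒜 : Set (Set ℕ+),
      (∀ L ∈ 𝒜, L.Infinite) ∧
      Cardinal.mk 𝒜 = Cardinal.continuum ∧
      ∀ L ∈ 𝒜, ∀ M ∈ 𝒜, L ≠ M →
        BanachIncomparable (SchreierSubspace ξ L) (SchreierSubspace ξ M) := by
  obtain ⟨B, w, q, h⟩ := exists_isThinBlocks ξ
  refine ⟨Set.range fun f : ℕ → Bool => blockUnion B (initialSegmentCodes f), ?_, ?_, ?_⟩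
  · rintro _ ⟨f, rfl⟩
    exact h.blockUnion_infinite (infinite_initialSegmentCodes f)
  · refine (Cardinal.mk_range_eq _
      (h.blockUnion_injective.comp initialSegmentCodes_injective)).trans ?_
    simp
  · rintro _ ⟨f, rfl⟩ _ ⟨g, rfl⟩ hne
    have hfg : f ≠ g := fun e => hne (by rw [e])
    exact ⟨h.not_embeds hξ (infinite_initialSegmentCodes_diff hfg),
      h.not_embeds hξ (infinite_initialSegmentCodes_diff hfg.symm)⟩
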